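/- There is a universal constant $C>0$ with the following property. Let $n,m,R\ge 1$ be integers, let $\boldsymbol u_1,\dots,\boldsymbol u_R\in\mathbb R^n$ be orthonormal, let $\boldsymbol v_1,\dots,\boldsymbol v_R\in\mathbb R^m$ be orthonormal, let $\beta_1\ge\beta_2\ge\dots\ge\beta_R>0$ and $\sigma>0$, and put $$\boldsymbol X=\sum_{r=1}^R\beta_r\,\boldsymbol u_r\boldsymbol v_r^\top,\qquad \tilde{\boldsymbol X}=\boldsymbol X+\sigma\boldsymbol E,$$ where $\boldsymbol E$ is an $n\times m$ random matrix whose entries are independent standard normal random variables. Let $\boldsymbol U=[\boldsymbol u_1,\dots,\boldsymbol u_R]$, and let $\hat{\boldsymbol U}\in\mathbb R^{n\times R}$ be a matrix whose columns are orthonormal left singular vectors of $\tilde{\boldsymbol X}$ (eigenvectors of $\tilde{\boldsymbol X}\tilde{\boldsymbol X}^\top$) for its $R$ largest singular values. Write $\cos(\hat{\boldsymbol U},\boldsymbol U)$ for the cosine of the largest principal angle between the column spaces of $\hat{\boldsymbol U}$ and $\boldsymbol U$, i.e. the smallest singular value of $\boldsymbol U^\top\hat{\boldsymbol U}$. Then,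 with probability at least $1-3e^{-n}$, the following holds (for every admissible choice of $\hat{\boldsymbol U}$). If $m/n\ge C(\beta_1/\beta_R)^4$, then $$\bigl|\cos(\hat{\boldsymbol U},\boldsymbol U)\bigr|\ \ge\ \begin{cases}1-\dfrac{C\,mn}{(\beta_R/\sigma)^4}, & \text{if }\ \dfrac{\beta_1}{\sqrt m}<\sigma\le\dfrac{\beta_R}{(Cmn)^{1/4}},\\[2ex] 1-\dfrac{C\,n\,(\beta_1/\beta_R)^2}{(\beta_R/\sigma)^2}, & \text{if }\ \sigma\le\dfrac{\beta_1}{\sqrt m};\end{cases}$$ otherwise, i.e. if $m/n< C(\beta_1/\beta_R)^4$, $$\bigl|\cos(\hat{\boldsymbol U},\boldsymbol U)\bigr|\ \ge\ 1-\frac{C\,n\,(\beta_1/\beta_R)^2}{(\beta_R/\sigma)^2}\qquad\text{if }\ \sigma\le\frac{\beta_R^2}{(Cn)^{1/2}\,\beta_1}.$$ -/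

import Mathlib

open MeasureTheory ProbabilityTheory

noncomputable section

/-- The signal matrix `X = ∑ r, β r • u r (v r)ᵀ`, of size `n × m`. -/
def signalMatrix {n m R : ℕ} (β : Fin R → ℝ) (u : Fin R → EuclideanSpace ℝ (Fin n))
    (v : Fin R → EuclideanSpace ℝ (Fin m)) : Matrix (Fin n) (Fin m) ℝ :=
  ∑ r, β r • Matrix.vecMulVec (u r).ofLp (v r).ofLp

/-- `û 0, …, û (R - 1)` are top-`R` left singular vectors of `A`: the first `R` members of an
orthonormal basis `w` of `ℝⁿ` that consists of left singular vectors of `A`, that is, of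
eigenvectors of `A Aᵀ` with eigenvalues `s i ^ 2`, where the singular values `s i ≥ 0` are listed
in decreasing order. (If singular values coincide, there are several such families.) -/
def IsTopLeftSingularVectors {n m R : ℕ} (A : Matrix (Fin n) (Fin m) ℝ)
    (û : Fin R → EuclideanSpace ℝ (Fin n)) : Prop :=
  ∃ (hRn : R ≤ n) (w : OrthonormalBasis (Fin n) ℝ (EuclideanSpace ℝ (Fin n))) (s : Fin n → ℝ),
    Antitone s ∧ (∀ i, 0 ≤ s i) ∧
    (∀ i, (A * A.transpose).mulVec (w i).ofLp = s i ^ 2 • (w i).ofLp) ∧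
    ∀ r, û r = w (Fin.castLE hRn r)

/-- The cosine of the largest principal angle between two nonzero subspaces `V` and `W` of equal
dimension: the minimum of `‖P_W x‖` over unit vectors `x` of `V`, where `P_W` is the orthogonal
projection. If the columns of the matrices `V₀` and `W₀` are orthonormal bases of `V` and `W`, it is
the smallest singular value of `W₀ᵀ V₀`, and it equals `√(1 - ‖W₁ᵀ V₀‖ ^ 2)` when the columns of
`W₁` are an orthonormal basis of the orthogonal complement of `W` (spectral norm). -/
def subspaceCos {n : ℕ} (V W : Submodule ℝ (EuclideanSpace ℝ (Fin n))) : ℝ :=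
  ⨅ x : {x : EuclideanSpace ℝ (Fin n) // x ∈ V ∧ ‖x‖ = 1}, ‖W.starProjection x.1‖

end

/-!
The left singular vectors of `X̃ = X + σ E` are the eigenvectors of `X̃ X̃ᵀ`, and
`X̃ X̃ᵀ = X Xᵀ + σ² m + D` with `D = σ (E Xᵀ + X Eᵀ) + σ² (E Eᵀ - m)`. The multiple of the identity
moves no eigenvector, so the noise enters through `D` only.

*Perturbation.* `X Xᵀ` has range `span u` and is at least `β_R²` there. If `‖D‖ ≤ δ` and
`2 δ ≤ β_R²`, Weyl's inequality keeps the top `R` eigenvalues of `X Xᵀ + D` at least `β_R² / 2`, so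
a unit vector `x` of their eigenspace is `(X Xᵀ + D) y` with `‖y‖ ≤ 2 / β_R²`. As `X Xᵀ y ∈ span u`,
`x` is within `2 δ / β_R²` of `span u`, and the cosine is at least `1 - 4 δ² / β_R⁴`
(`one_sub_le_norm_starProjection_of_perturbation`). For `2 δ > β_R²` this bound is negative.

*Concentration.* For an orthonormal family `w` of `k` vectors in `ℝᵐ` and a unit vector `x`, the
numbers `⟪E (w r), x⟫` are independent standard normal, so the sum of their squares is chi-square
with `k` degrees of freedom. A Chernoff bound and a net of `5 ^ n` points on the sphere give
`‖∑ ⟪E (w r), ·⟫ E (w r) - k‖ ≤ 544 (√(k n) + n)` outside an event of probability `exp (-n)`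
(`exists_event_norm_frame_mulVec_sub_le`). The standard basis of `ℝᵐ` bounds `E Eᵀ - m`; the family
`v` bounds `E (v r)` and with it the cross terms, by `66 σ β₁ √n`. Together
`‖D‖ ≤ 66 σ β₁ √n + 544 σ² (√(m n) + n)` (`norm_gram_sub_le`).

*Regimes.* In each range of `σ` one of `σ β₁ √n` and `σ² √(m n)` dominates all three terms
(`one_sub_le_of_noise_regime`).
-/

/-! ### Nets on the sphere and operator norms -/

/-- The net is a `1/2`-separated set of unit vectors of maximal cardinality. Scaled by `2` it is
`1`-separated in the ball of radius `2`, and so has at most `5 ^ dim` points by volume. -/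
lemma exists_sphere_net (H : Type*) [NormedAddCommGroup H] [NormedSpace ℝ H]
    [FiniteDimensional ℝ H] :
    ∃ N : Finset H, N.card ≤ 5 ^ Module.finrank ℝ H ∧ (∀ y ∈ N, ‖y‖ = 1) ∧
      ∀ x : H, ‖x‖ = 1 → ∃ y ∈ N, ‖x - y‖ ≤ 1 / 2 := by
  classical
  let Q : ℕ → Prop := fun k => ∃ N : Finset H, N.card = k ∧ (∀ y ∈ N, ‖y‖ = 1) ∧
    ∀ c ∈ N, ∀ d ∈ N, c ≠ d → 1 / 2 ≤ ‖c - d‖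
  have hcard : ∀ N : Finset H, (∀ y ∈ N, ‖y‖ = 1) →
      (∀ c ∈ N, ∀ d ∈ N, c ≠ d → 1 / 2 ≤ ‖c - d‖) → N.card ≤ 5 ^ Module.finrank ℝ H := by
    intro N h1 h2
    have hinj : Function.Injective (fun x : H => (2 : ℝ) • x) :=
      smul_right_injective H two_ne_zero
    rw [← Finset.card_image_of_injective N hinj]
    apply Besicovitch.card_le_of_separated
    · intro c hc
      obtain ⟨y, hy, rfl⟩ := Finset.mem_image.1 hc
      simp [norm_smul, h1 y hy]
    · intro c hc d hd hcd
      obtain ⟨y, hy, rfl⟩ := Finset.mem_image.1 hc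
      obtain ⟨z, hz, rfl⟩ := Finset.mem_image.1 hd
      have hyz : y ≠ z := fun h => hcd (by rw [h])
      have := h2 y hy z hz hyz
      rw [← smul_sub, norm_smul, Real.norm_two]
      linarith
  have hQ0 : Q 0 := ⟨∅, by simp⟩
  obtain ⟨N, hN, h1, h2⟩ : Q (Nat.findGreatest Q (5 ^ Module.finrank ℝ H)) :=
    Nat.findGreatest_spec (Nat.zero_le _) hQ0
  refine ⟨N, hcard N h1 h2, h1, fun x hx => ?_⟩
  by_contra! hfar
  have hxN : x ∉ N := fun h => by
    have := hfar x h
    norm_num at this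
  have h1' : ∀ y ∈ insert x N, ‖y‖ = 1 := by
    simpa [hx] using h1
  have h2' : ∀ c ∈ insert x N, ∀ d ∈ insert x N, c ≠ d → 1 / 2 ≤ ‖c - d‖ := by
    intro c hc d hd hcd
    rcases Finset.mem_insert.1 hc with hcx | hc' <;>
      rcases Finset.mem_insert.1 hd with hdx | hd'
    · exact absurd (hcx.trans hdx.symm) hcd
    · rw [hcx]; exact (hfar d hd').le
    · rw [hdx, norm_sub_rev]; exact (hfar c hc').le
    · exact h2 c hc' d hd' hcd
  have := Nat.le_findGreatest (P := Q) (hcard _ h1' h2') ⟨insert x N, rfl, h1', h2'⟩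
  rw [Finset.card_insert_of_notMem hxN] at this
  omega

/-- The operator norm is the supremum of the quadratic form on unit vectors, and passing from a unit
vector `x` to a net point `y` costs `⟪T (x - y), x + y⟫`, where
`‖x - y‖² ‖x + y‖² = t² (4 - t²) ≤ 15 / 16` for `t = ‖x - y‖ ≤ 1 / 2`. -/
lemma LinearMap.IsSymmetric.opNorm_le_of_net {H : Type*} [NormedAddCommGroup H]
    [InnerProductSpace ℝ H] {T : H →L[ℝ] H} (hT : (T : H →ₗ[ℝ] H).IsSymmetric) {N : Finset H}
    (hN1 : ∀ y ∈ N, ‖y‖ = 1) (hN : ∀ x : H, ‖x‖ = 1 → ∃ y ∈ N, ‖x - y‖ ≤ 1 / 2) {M : ℝ}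
    (hM0 : 0 ≤ M) (hM : ∀ y ∈ N, |inner ℝ (T y) y| ≤ M) : ‖T‖ ≤ 32 * M := by
  have hsymm : ∀ x y, inner ℝ (T x) y = inner ℝ (T y) x := fun x y => by
    rw [real_inner_comm]; exact (hT y x).symm
  have hq : ∀ x, ‖x‖ = 1 → |inner ℝ (T x) x| ≤ M + 31 / 32 * ‖T‖ := by
    intro x hx
    obtain ⟨y, hy, hxy⟩ := hN x hx
    have hy1 := hN1 y hy
    have hdiff : inner ℝ (T x) x = inner ℝ (T y) y + inner ℝ (T (x - y)) (x + y) := by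
      simp only [map_sub, inner_sub_left, inner_add_right]
      rw [hsymm x y]; ring
    have hpar := parallelogram_law_with_norm ℝ x y
    rw [hx, hy1] at hpar
    have hprod : ‖x - y‖ * ‖x + y‖ ≤ 31 / 32 := by
      apply le_of_sq_le_sq _ (by norm_num)
      have h0 := norm_nonneg (x - y)
      have : ‖x + y‖ ^ 2 = 4 - ‖x - y‖ ^ 2 := by nlinarith
      have h2 : ‖x - y‖ ^ 2 ≤ 1 / 4 := by nlinarith
      rw [mul_pow, this]
      nlinarith
    have hb : |inner ℝ (T (x - y)) (x + y)| ≤ 31 / 32 * ‖T‖ := by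
      calc _ ≤ ‖T (x - y)‖ * ‖x + y‖ := abs_real_inner_le_norm _ _
        _ ≤ (‖T‖ * ‖x - y‖) * ‖x + y‖ := by gcongr; exact T.le_opNorm _
        _ = ‖T‖ * (‖x - y‖ * ‖x + y‖) := by ring
        _ ≤ ‖T‖ * (31 / 32) := by gcongr
        _ = _ := by ring
    rw [hdiff]
    exact (abs_add_le _ _).trans (add_le_add (hM y hy) hb)
  have hq' : ∀ x, |inner ℝ (T x) x| ≤ (M + 31 / 32 * ‖T‖) * ‖x‖ ^ 2 := by
    intro x
    rcases eq_or_ne x 0 with rfl | hx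
    · simp
    have hx' : ‖x‖ ≠ 0 := norm_ne_zero_iff.2 hx
    have := hq (‖x‖⁻¹ • x) (by simp [norm_smul, hx'])
    rw [map_smul, inner_smul_left, inner_smul_right, ← mul_assoc, abs_mul] at this
    simp only [conj_trivial, abs_mul, abs_inv, abs_norm] at this
    calc |inner ℝ (T x) x| = (‖x‖⁻¹ * ‖x‖⁻¹ * |inner ℝ (T x) x|) * ‖x‖ ^ 2 := by field_simp
      _ ≤ _ := by gcongr
  have hop : ‖T‖ ≤ M + 31 / 32 * ‖T‖ := by
    refine (T.norm_eq_iSup_rayleighQuotient hT).trans_le (ciSup_le fun x => ?_)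
    rw [ContinuousLinearMap.rayleighQuotient, ContinuousLinearMap.reApplyInnerSelf_apply,
      RCLike.re_to_real, abs_div, abs_sq]
    exact div_le_of_le_mul₀ (sq_nonneg _) (by positivity) (hq' x)
  linarith

/-- If the frame operator `x ↦ ∑ ⟪a r, x⟫ a r` is close to `c • id` as a quadratic form on the net,
it is close to it in operator norm. -/
lemma norm_frame_sub_smul_le_of_net {H ι : Type*} [Fintype ι] [NormedAddCommGroup H]
    [InnerProductSpace ℝ H] (a : ι → H) (c : ℝ) {N : Finset H}
    (hN1 : ∀ y ∈ N, ‖y‖ = 1) (hN : ∀ x : H, ‖x‖ = 1 → ∃ y ∈ N, ‖x - y‖ ≤ 1 / 2) {M : ℝ}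
    (hM0 : 0 ≤ M) (hM : ∀ y ∈ N, |∑ r, inner ℝ (a r) y ^ 2 - c| ≤ M) (x : H) :
    ‖∑ r, inner ℝ (a r) x • a r - c • x‖ ≤ 32 * M * ‖x‖ := by
  let T : H →L[ℝ] H := ∑ r, (innerSL ℝ (a r)).smulRight (a r) - c • ContinuousLinearMap.id ℝ H
  have hTx : ∀ x, T x = ∑ r, inner ℝ (a r) x • a r - c • x := fun x => by
    simp [T]
  have hT : (T : H →ₗ[ℝ] H).IsSymmetric := by
    intro x y
    simp only [ContinuousLinearMap.coe_coe, hTx, inner_sub_left, inner_sub_right, sum_inner,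
      inner_sum, inner_smul_left, inner_smul_right, conj_trivial]
    congr 1
    refine Finset.sum_congr rfl fun r _ => ?_
    rw [real_inner_comm x (a r)]; ring
  rw [← hTx]
  refine (T.le_opNorm x).trans ?_
  gcongr
  refine hT.opNorm_le_of_net hN1 hN hM0 fun y hy => ?_
  convert hM y hy using 2
  simp [hTx, inner_sub_left, sum_inner, inner_smul_left, hN1 y hy, sq]

/-! ### Gaussian vectors and the chi-square tail -/

lemma Orthonormal.norm_sum_smul_sq {H ι : Type*} [Fintype ι] [NormedAddCommGroup H]
    [InnerProductSpace ℝ H] {u : ι → H} (hu : Orthonormal ℝ u) (t : ι → ℝ) :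
    ‖∑ r, t r • u r‖ ^ 2 = ∑ r, t r ^ 2 := by
  rw [← real_inner_self_eq_norm_sq, hu.inner_sum]
  simp [sq]

/-- The law of `ω ↦ (⟪a r, G ω⟫)_r` for orthonormal `a`. -/
lemma stdGaussian_map_inner_orthonormal {H ι : Type*} [Fintype ι] [NormedAddCommGroup H]
    [InnerProductSpace ℝ H] [FiniteDimensional ℝ H] [MeasurableSpace H] [BorelSpace H]
    {a : ι → H} (ha : Orthonormal ℝ a) :
    (stdGaussian H).map (fun g => WithLp.toLp 2 fun r => inner ℝ (a r) g) =
      stdGaussian (EuclideanSpace ℝ ι) := by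
  have hmeas : Measurable fun g : H => WithLp.toLp 2 fun r => inner ℝ (a r) g := by fun_prop
  have := Measure.isProbabilityMeasure_map (μ := stdGaussian H) hmeas.aemeasurable
  apply Measure.ext_of_charFun
  ext t
  have hnorm : ‖t‖ ^ 2 = ‖∑ r, t r • a r‖ ^ 2 := by
    rw [ha.norm_sum_smul_sq, EuclideanSpace.real_norm_sq_eq]
  rw [charFun_stdGaussian, ← Complex.ofReal_pow, hnorm, Complex.ofReal_pow, ← charFun_stdGaussian,
    charFun_apply, charFun_apply, integral_map hmeas.aemeasurable (by fun_prop)]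
  congr 1
  ext g
  congr 3
  simp [PiLp.inner_apply, inner_sum, inner_smul_right, real_inner_comm]

lemma Real.exp_neg_add_two_mul_sq_le {s : ℝ} (hs : |s| ≤ 1 / 2) :
    Real.exp (-(s + 2 * s ^ 2)) ≤ 1 - s := by
  have h := Real.abs_log_sub_add_sum_range_le (x := s) (by linarith) 1
  simp only [Finset.range_one, Finset.sum_singleton, zero_add, pow_one, Nat.cast_zero, div_one,
    sq_abs, Nat.reduceAdd] at h
  have h2 : s ^ 2 / (1 - |s|) ≤ 2 * s ^ 2 := by
    rw [div_le_iff₀ (by linarith)]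
    nlinarith [sq_nonneg s]
  have hpos : 0 < 1 - s := by linarith [le_abs_self s]
  rw [← Real.le_log_iff_exp_le hpos]
  linarith [(abs_le.1 (h.trans h2)).1]

lemma integrable_exp_mul_sq_gaussianReal {l : ℝ} (hl : l < 1 / 2) :
    Integrable (fun x => Real.exp (l * x ^ 2)) (gaussianReal 0 1) := by
  rw [gaussianReal_of_var_ne_zero 0 one_ne_zero,
    integrable_withDensity_iff_integrable_smul' (by fun_prop) (by simp [gaussianPDF])]
  refine ((integrable_exp_neg_mul_sq (b := 1 / 2 - l) (by linarith)).const_mul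
    (√(2 * Real.pi))⁻¹).congr (ae_of_all _ fun x => ?_)
  simp only [toReal_gaussianPDF, gaussianPDFReal, NNReal.coe_one, mul_one, sub_zero, smul_eq_mul]
  rw [mul_assoc, ← Real.exp_add]
  ring_nf

lemma integral_exp_mul_sq_gaussianReal {l : ℝ} (hl : l < 1 / 2) :
    ∫ x, Real.exp (l * x ^ 2) ∂(gaussianReal 0 1) = √(1 / (1 - 2 * l)) := by
  rw [integral_gaussianReal_eq_integral_smul one_ne_zero]
  have : ∀ x, gaussianPDFReal 0 1 x • Real.exp (l * x ^ 2) =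
      (√(2 * Real.pi))⁻¹ * Real.exp (-(1 / 2 - l) * x ^ 2) := fun x => by
    simp only [gaussianPDFReal, NNReal.coe_one, mul_one, sub_zero, smul_eq_mul]
    rw [mul_assoc, ← Real.exp_add]
    ring_nf
  simp_rw [this]
  rw [integral_const_mul, integral_gaussian, ← Real.sqrt_inv, ← Real.sqrt_mul (by positivity)]
  congr 1
  have : 1 - 2 * l ≠ 0 := by linarith
  have : 1 / 2 - l ≠ 0 := by linarith
  field_simp

lemma integral_exp_mul_sq_gaussianReal_le {l : ℝ} (hl : |l| ≤ 1 / 4) :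
    ∫ x, Real.exp (l * x ^ 2) ∂(gaussianReal 0 1) ≤ Real.exp (l + 4 * l ^ 2) := by
  have hl' := abs_le.1 hl
  rw [integral_exp_mul_sq_gaussianReal (by linarith)]
  apply Real.sqrt_le_iff.2 ⟨(Real.exp_pos _).le, ?_⟩
  have h := Real.exp_neg_add_two_mul_sq_le (s := 2 * l) (by rw [abs_mul, abs_two]; linarith)
  have hpos : 0 < 1 - 2 * l := by linarith
  rw [div_le_iff₀ hpos, ← Real.exp_nat_mul]
  calc (1 : ℝ) = Real.exp ((2 : ℕ) * (l + 4 * l ^ 2)) * Real.exp (-(2 * l + 2 * (2 * l) ^ 2)) := by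
        rw [← Real.exp_add, eq_comm, Real.exp_eq_one_iff]; push_cast; ring
    _ ≤ _ := by gcongr

section ChiSquare

variable {ι : Type*} [Fintype ι] {l : ℝ}

lemma integrable_exp_mul_norm_sq_stdGaussian (hl : l < 1 / 2) :
    Integrable (fun g : EuclideanSpace ℝ ι => Real.exp (l * (‖g‖ ^ 2 - Fintype.card ι)))
      (stdGaussian (EuclideanSpace ℝ ι)) := by
  rw [← map_pi_eq_stdGaussian, integrable_map_measure (by fun_prop) (by fun_prop)]
  refine ((Integrable.fintype_prod (ι := ι) (f := fun _ x => Real.exp (l * x ^ 2))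
    fun _ => integrable_exp_mul_sq_gaussianReal hl).const_mul
      (Real.exp (-l * Fintype.card ι))).congr (ae_of_all _ fun x => ?_)
  simp only [Function.comp, EuclideanSpace.real_norm_sq_eq]
  rw [← Real.exp_sum, ← Real.exp_add, ← Finset.mul_sum]
  ring_nf

lemma mgf_norm_sq_sub_card_stdGaussian_le (hl : |l| ≤ 1 / 4) :
    mgf (fun g : EuclideanSpace ℝ ι => ‖g‖ ^ 2 - Fintype.card ι)
      (stdGaussian (EuclideanSpace ℝ ι)) l ≤ Real.exp (4 * l ^ 2 * Fintype.card ι) := by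
  rw [mgf, ← map_pi_eq_stdGaussian, integral_map (by fun_prop) (by fun_prop)]
  have : ∀ x : ι → ℝ, Real.exp (l * (‖WithLp.toLp 2 x‖ ^ 2 - Fintype.card ι)) =
      Real.exp (-l * Fintype.card ι) * ∏ i, Real.exp (l * x i ^ 2) := fun x => by
    rw [EuclideanSpace.real_norm_sq_eq, ← Real.exp_sum, ← Real.exp_add, ← Finset.mul_sum]
    ring_nf
  simp_rw [this]
  rw [integral_const_mul, integral_fintype_prod_eq_prod (fun _ x => Real.exp (l * x ^ 2)),
    Finset.prod_const, Finset.card_univ]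
  calc _ ≤ Real.exp (-l * Fintype.card ι) * Real.exp (l + 4 * l ^ 2) ^ Fintype.card ι := by
        gcongr
        exact integral_exp_mul_sq_gaussianReal_le hl
    _ = _ := by
        rw [← Real.exp_nat_mul, ← Real.exp_add]
        ring_nf

/-- The choice `l = ± n / (4 (√(k n) + n))` in the Chernoff bound keeps `|l| ≤ 1 / 4` and
`l ^ 2 * k ≤ n / 16`, so that the exponent is at most `n / 4 - 17 n / 4`. -/
lemma measure_norm_sq_sub_card_stdGaussian_le {n : ℝ} (hn : 0 < n) :
    (stdGaussian (EuclideanSpace ℝ ι)).real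
      {g | 17 * (√(Fintype.card ι * n) + n) ≤ |‖g‖ ^ 2 - Fintype.card ι|} ≤
      2 * Real.exp (-4 * n) := by
  set k : ℝ := (Fintype.card ι : ℝ) with hk
  have hk0 : 0 ≤ k := by positivity
  set b := √(k * n) + n with hb
  have hb0 : 0 < b := by positivity
  set l := n / (4 * b) with hl
  have hl0 : 0 ≤ l := by positivity
  have hlb : l * b = n / 4 := by rw [hl]; field_simp
  have hl1 : l ≤ 1 / 4 := by
    rw [hl, div_le_iff₀ (by positivity)]
    linarith [Real.sqrt_nonneg (k * n)]
  have hl2 : l ^ 2 * k ≤ n / 16 := by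
    have h1 : k * n ≤ b ^ 2 := by
      rw [← Real.sqrt_le_left hb0.le]; linarith
    have h2 : l ^ 2 * (k * n) ≤ n ^ 2 / 16 := by
      calc _ ≤ l ^ 2 * b ^ 2 := by gcongr
        _ = _ := by rw [← mul_pow, hlb]; ring
    have h3 : (l ^ 2 * k) * n ≤ (n / 16) * n := by linarith
    exact le_of_mul_le_mul_right h3 hn
  set μ := stdGaussian (EuclideanSpace ℝ ι)
  set Y : EuclideanSpace ℝ ι → ℝ := fun g => ‖g‖ ^ 2 - k
  have hsub : {g | 17 * b ≤ |Y g|} ⊆ {g | 17 * b ≤ Y g} ∪ {g | Y g ≤ -(17 * b)} := by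
    intro g hg
    simp only [Set.mem_ofPred_eq] at hg
    rcases le_abs.1 hg with h | h
    · exact Or.inl h
    · exact Or.inr (by simp only [Set.mem_ofPred_eq]; linarith)
  have hup : μ.real {g | 17 * b ≤ Y g} ≤ Real.exp (-4 * n) := by
    calc _ ≤ Real.exp (-l * (17 * b)) * mgf Y μ l :=
          measure_ge_le_exp_mul_mgf _ hl0 (integrable_exp_mul_norm_sq_stdGaussian (by linarith))
      _ ≤ Real.exp (-l * (17 * b)) * Real.exp (4 * l ^ 2 * k) := by
          gcongr
          exact mgf_norm_sq_sub_card_stdGaussian_le (by rwa [abs_of_nonneg hl0])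
      _ ≤ _ := by
          rw [← Real.exp_add]
          gcongr
          nlinarith
  have hlo : μ.real {g | Y g ≤ -(17 * b)} ≤ Real.exp (-4 * n) := by
    calc _ ≤ Real.exp (-(-l) * -(17 * b)) * mgf Y μ (-l) :=
          measure_le_le_exp_mul_mgf _ (by linarith)
            (integrable_exp_mul_norm_sq_stdGaussian (by linarith))
      _ ≤ Real.exp (-(-l) * -(17 * b)) * Real.exp (4 * (-l) ^ 2 * k) := by
          gcongr
          exact mgf_norm_sq_sub_card_stdGaussian_le (by rwa [abs_neg, abs_of_nonneg hl0])
      _ ≤ _ := by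
          rw [← Real.exp_add]
          gcongr
          nlinarith
  calc _ ≤ μ.real ({g | 17 * b ≤ Y g} ∪ {g | Y g ≤ -(17 * b)}) := measureReal_mono hsub
    _ ≤ _ := measureReal_union_le _ _
    _ ≤ _ := by linarith

end ChiSquare

/-! ### Concentration of frame operators of a Gaussian matrix -/

/-- `x ⊗ w r`, for a unit vector `x` and an orthonormal family `w`, is orthonormal. -/
lemma orthonormal_vecMulVec {κ n m : Type*} [Fintype n] [Fintype m]
    {x : EuclideanSpace ℝ n} (hx : ‖x‖ = 1) {w : κ → EuclideanSpace ℝ m}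
    (hw : Orthonormal ℝ w) :
    Orthonormal ℝ fun r => WithLp.toLp 2 fun p : n × m => x p.1 * w r p.2 := by
  classical
  rw [orthonormal_iff_ite] at hw ⊢
  intro r s
  rw [← hw r s]
  have hx2 : ∑ i, x i * x i = 1 := by
    have := EuclideanSpace.real_norm_sq_eq x
    rw [hx] at this
    simpa [sq] using this.symm
  calc _ = ∑ i, ∑ j, (x i * x i) * (w s j * w r j) := by
        simp only [PiLp.inner_apply, RCLike.inner_apply, conj_trivial, Fintype.sum_prod_type]
        exact Finset.sum_congr rfl fun i _ => Finset.sum_congr rfl fun j _ => by ring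
    _ = _ := by
        simp_rw [← Finset.mul_sum]
        rw [← Finset.sum_mul, hx2, one_mul]
        simp [PiLp.inner_apply]

section GaussianMatrix

variable {Ω : Type*} [MeasurableSpace Ω] {P : Measure Ω} [IsProbabilityMeasure P]

lemma hasLaw_stdGaussian_of_iIndepFun {ι : Type*} [Fintype ι] {X : ι → Ω → ℝ}
    (hlaw : ∀ i, HasLaw (X i) (gaussianReal 0 1) P) (hind : iIndepFun X P) :
    HasLaw (fun ω => WithLp.toLp 2 fun i => X i ω) (stdGaussian (EuclideanSpace ℝ ι)) P where
  aemeasurable := by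
    have : ∀ i, AEMeasurable (X i) P := fun i => (hlaw i).aemeasurable
    fun_prop
  map_eq := by
    have hm : ∀ i, AEMeasurable (X i) P := fun i => (hlaw i).aemeasurable
    have h := (iIndepFun_iff_map_fun_eq_pi_map hm).1 hind
    simp_rw [(hlaw _).map_eq] at h
    rw [← map_pi_eq_stdGaussian, ← h, AEMeasurable.map_map_of_aemeasurable (by fun_prop)
      (by fun_prop)]
    rfl

variable {n m : ℕ} {E : Ω → Matrix (Fin n) (Fin m) ℝ}

/-- For a unit vector `x`, the coordinates of `Eᵀ x` along an orthonormal family are jointly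
standard Gaussian. -/
lemma hasLaw_inner_mulVec
    (hlaw : ∀ i j, HasLaw (fun ω => E ω i j) (gaussianReal 0 1) P)
    (hind : iIndepFun (fun (p : Fin n × Fin m) (ω : Ω) => E ω p.1 p.2) P)
    {κ : Type*} [Fintype κ] {w : κ → EuclideanSpace ℝ (Fin m)}
    (hw : Orthonormal ℝ w) {x : EuclideanSpace ℝ (Fin n)} (hx : ‖x‖ = 1) :
    HasLaw (fun ω => WithLp.toLp 2 fun r =>
        inner ℝ (WithLp.toLp 2 ((E ω).mulVec (w r).ofLp)) x)
      (stdGaussian (EuclideanSpace ℝ κ)) P := by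
  have hG := hasLaw_stdGaussian_of_iIndepFun (fun p : Fin n × Fin m => hlaw p.1 p.2) hind
  have hT : HasLaw (fun g => WithLp.toLp 2 fun r => inner ℝ
      (WithLp.toLp 2 fun p : Fin n × Fin m => x p.1 * w r p.2) g)
      (stdGaussian (EuclideanSpace ℝ κ)) (stdGaussian (EuclideanSpace ℝ (Fin n × Fin m))) :=
    ⟨by fun_prop, stdGaussian_map_inner_orthonormal (orthonormal_vecMulVec hx hw)⟩
  convert hT.comp hG using 2 with ω
  simp only [Function.comp]
  congr 1
  ext r
  simp only [PiLp.inner_apply, RCLike.inner_apply, conj_trivial, Fintype.sum_prod_type,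
    Matrix.mulVec, dotProduct, Finset.mul_sum]
  exact Finset.sum_congr rfl fun i _ => Finset.sum_congr rfl fun j _ => by ring

/-- The frame operator of the vectors `E (w r)` is close to `k • id`, with `k` their number.
The union bound runs over a net of at most `5 ^ n ≤ exp (2 n)` points; the two tails at each point
contribute `2 exp (-4 n) ≤ exp (n - 4 n)`. -/
lemma exists_event_norm_frame_mulVec_sub_le
    (hlaw : ∀ i j, HasLaw (fun ω => E ω i j) (gaussianReal 0 1) P)
    (hind : iIndepFun (fun (p : Fin n × Fin m) (ω : Ω) => E ω p.1 p.2) P)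
    (hn : 0 < n) {κ : Type*} [Fintype κ]
    {w : κ → EuclideanSpace ℝ (Fin m)} (hw : Orthonormal ℝ w) :
    ∃ B : Set Ω, P B ≤ ENNReal.ofReal (Real.exp (-n)) ∧ ∀ ω ∉ B,
      ∀ x : EuclideanSpace ℝ (Fin n),
        ‖∑ r, inner ℝ (WithLp.toLp 2 ((E ω).mulVec (w r).ofLp)) x •
            (WithLp.toLp 2 ((E ω).mulVec (w r).ofLp) : EuclideanSpace ℝ (Fin n)) -
            (Fintype.card κ : ℝ) • x‖ ≤
          544 * (√(Fintype.card κ * n) + n) * ‖x‖ := by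
  obtain ⟨N, hNcard, hN1, hN⟩ := exists_sphere_net (EuclideanSpace ℝ (Fin n))
  rw [finrank_euclideanSpace_fin] at hNcard
  set k : ℝ := (Fintype.card κ : ℝ)
  set M := 17 * (√(k * n) + n) with hM
  have hM0 : 0 ≤ M := by positivity
  let F : Ω → κ → EuclideanSpace ℝ (Fin n) := fun ω r =>
    WithLp.toLp 2 ((E ω).mulVec (w r).ofLp)
  let B : EuclideanSpace ℝ (Fin n) → Set Ω := fun y =>
    {ω | M ≤ |∑ r, inner ℝ (F ω r) y ^ 2 - k|}
  have hgood : ∀ ω ∉ ⋃ y ∈ N, B y, ∀ x, ‖∑ r, inner ℝ (F ω r) x • F ω r - k • x‖ ≤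
      544 * (√(k * n) + n) * ‖x‖ := by
    intro ω hω x
    simp only [Set.mem_iUnion, not_exists] at hω
    have := norm_frame_sub_smul_le_of_net (F ω) k hN1 hN hM0
      (fun y hy => (not_le.1 (hω y hy)).le) x
    rwa [hM, ← mul_assoc, show (32 : ℝ) * 17 = 544 by norm_num] at this
  have hB : ∀ y ∈ N, P (B y) ≤ ENNReal.ofReal (2 * Real.exp (-4 * n)) := by
    intro y hy
    have hl := hasLaw_inner_mulVec hlaw hind hw (hN1 y hy)
    have hset : MeasurableSet {g : EuclideanSpace ℝ κ | M ≤ |‖g‖ ^ 2 - k|} :=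
      measurableSet_le measurable_const (by fun_prop)
    have h := measure_norm_sq_sub_card_stdGaussian_le (ι := κ) (n := (n : ℝ)) (by positivity)
    rw [← ofReal_measureReal]
    refine ENNReal.ofReal_le_ofReal (le_trans (le_of_eq ?_) h)
    rw [← hl.map_eq, measureReal_def, measureReal_def, Measure.map_apply_of_aemeasurable
      hl.aemeasurable hset]
    simp only [B, F, Set.preimage_ofPred_eq, EuclideanSpace.real_norm_sq_eq]
  refine ⟨⋃ y ∈ N, B y, ?_, hgood⟩
  calc P (⋃ y ∈ N, B y) ≤ ∑ y ∈ N, P (B y) := measure_biUnion_finset_le _ _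
    _ ≤ ∑ y ∈ N, ENNReal.ofReal (2 * Real.exp (-4 * n)) := Finset.sum_le_sum hB
    _ = ENNReal.ofReal (N.card * (2 * Real.exp (-4 * n))) := by
        rw [Finset.sum_const, nsmul_eq_mul,
          ENNReal.ofReal_mul (p := (N.card : ℝ)) (by positivity), ENNReal.ofReal_natCast]
    _ ≤ _ := by
        apply ENNReal.ofReal_le_ofReal
        have he : (2 : ℝ) ≤ Real.exp 1 := by linarith [Real.add_one_le_exp (1 : ℝ)]
        have h5 : (5 : ℝ) ≤ Real.exp 2 := by
          have h := Real.exp_one_gt_d9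
          rw [show (2 : ℝ) = 1 + 1 by norm_num, Real.exp_add]
          nlinarith
        have hc : (N.card : ℝ) ≤ Real.exp (2 * n) := by
          calc (N.card : ℝ) ≤ 5 ^ n := mod_cast hNcard
            _ ≤ Real.exp 2 ^ n := by gcongr
            _ = _ := by rw [← Real.exp_nat_mul, mul_comm]
        have h2 : (2 : ℝ) ≤ Real.exp n :=
          he.trans (Real.exp_le_exp.2 (mod_cast hn))
        calc _ ≤ Real.exp (2 * n) * (Real.exp n * Real.exp (-4 * n)) := by gcongr
          _ = _ := by rw [← Real.exp_add, ← Real.exp_add]; ring_nf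

end GaussianMatrix

/-! ### Perturbation of eigenspaces -/

section Perturbation

variable {n R : ℕ} {H : Type*} [NormedAddCommGroup H] [InnerProductSpace ℝ H]

/-- One half of Weyl's inequality. Some nonzero vector `z` of `span u` is orthogonal to the first
`R - 1` eigenvectors of `M`, so that `⟪M z, z⟫` is at most the `R`-th eigenvalue times `‖z‖²`. -/
lemma sub_le_eigenvalue_of_perturbation {u : Fin R → H} (hu : Orthonormal ℝ u) {γ : Fin R → ℝ}
    {g : ℝ} (hγ : ∀ r, g ≤ γ r) (hR : 0 < R) (hRn : R ≤ n) (w : OrthonormalBasis (Fin n) ℝ H)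
    {μ : Fin n → ℝ} (hμ : Antitone μ) {M : H →ₗ[ℝ] H} (hM : ∀ i, M (w i) = μ i • w i) {c δ : ℝ}
    (hδ : ∀ x, ‖M x - c • x - ∑ r, γ r • inner ℝ (u r) x • u r‖ ≤ δ * ‖x‖)
    (i : Fin n) (hi : (i : ℕ) < R) : g - δ ≤ μ i - c := by
  let Φ : (Fin R → ℝ) →ₗ[ℝ] (Fin (R - 1) → ℝ) := LinearMap.pi fun j =>
    (innerₗ H (w ⟨j, by omega⟩)) ∘ₗ (Fintype.linearCombination ℝ u)
  have hker : Φ.ker ≠ ⊥ := LinearMap.ker_ne_bot_of_finrank_lt (by simp; omega)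
  obtain ⟨t, ht, ht0⟩ := (Submodule.ne_bot_iff _).1 hker
  set z : H := ∑ r, t r • u r with hz
  have hzw : ∀ j : Fin n, (j : ℕ) < R - 1 → inner ℝ (w j) z = 0 := by
    intro j hj
    have := congrFun (LinearMap.mem_ker.1 ht) ⟨j, hj⟩
    simpa [Φ, Fintype.linearCombination_apply, hz, inner_sum, inner_smul_right] using this
  have hzn : ‖z‖ ^ 2 = ∑ r, t r ^ 2 := hu.norm_sum_smul_sq t
  have hzpos : 0 < ‖z‖ ^ 2 := by
    rw [hzn]
    obtain ⟨r, hr⟩ := Function.ne_iff.1 ht0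
    have hr' : t r ≠ 0 := hr
    exact Finset.sum_pos' (fun _ _ => sq_nonneg _) ⟨r, Finset.mem_univ r, by positivity⟩
  have hMz : inner ℝ (M z) z = ∑ j, μ j * inner ℝ (w j) z ^ 2 := by
    have hMz' : M z = ∑ j, inner ℝ (w j) z • μ j • w j := by
      conv_lhs => rw [← w.sum_repr' z]
      simp only [map_sum, map_smul, hM]
    simp only [hMz', sum_inner, inner_smul_left, conj_trivial]
    exact Finset.sum_congr rfl fun j _ => by ring
  have hup : inner ℝ (M z) z ≤ μ i * ‖z‖ ^ 2 := by
    rw [hMz, ← w.sum_sq_inner_right z, Finset.mul_sum]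
    refine Finset.sum_le_sum fun j _ => ?_
    by_cases hj : (j : ℕ) < R - 1
    · simp [hzw j hj]
    · have : μ j ≤ μ i := hμ (Fin.le_def.2 (by omega))
      gcongr
  have hAz : g * ‖z‖ ^ 2 ≤ inner ℝ (∑ r, γ r • inner ℝ (u r) z • u r) z := by
    have huz : ∀ r, inner ℝ (u r) z = t r := fun r => hu.inner_right_fintype t r
    simp only [sum_inner, inner_smul_left, conj_trivial, huz]
    rw [hzn, Finset.mul_sum]
    refine Finset.sum_le_sum fun r _ => ?_
    nlinarith [hγ r, sq_nonneg (t r)]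
  have herr := (abs_le.1 ((abs_real_inner_le_norm
    (M z - c • z - ∑ r, γ r • inner ℝ (u r) z • u r) z).trans
      (mul_le_mul_of_nonneg_right (hδ z) (norm_nonneg z)))).1
  rw [inner_sub_left, inner_sub_left, inner_smul_left, real_inner_self_eq_norm_sq,
    conj_trivial] at herr
  have : (g - δ) * ‖z‖ ^ 2 ≤ (μ i - c) * ‖z‖ ^ 2 := by nlinarith
  exact le_of_mul_le_mul_right this hzpos

/-- A sine-theta theorem. On the span of the top eigenvectors, `M - c` is invertible with inverse
of norm at most `1 / (g - δ)`; for `x = (M - c) y` the vector `∑ γ r ⟪u r, y⟫ u r` lies in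
`span u`, at distance at most `δ ‖y‖` from `x`. -/
lemma one_sub_le_norm_starProjection_of_perturbation [FiniteDimensional ℝ H]
    {u : Fin R → H} (hu : Orthonormal ℝ u)
    {γ : Fin R → ℝ} {g : ℝ} (hg : 0 < g) (hγ : ∀ r, g ≤ γ r) (hR : 0 < R) (hRn : R ≤ n)
    (w : OrthonormalBasis (Fin n) ℝ H) {μ : Fin n → ℝ} (hμ : Antitone μ) {M : H →ₗ[ℝ] H}
    (hM : ∀ i, M (w i) = μ i • w i) {c δ : ℝ}
    (hδ : ∀ x, ‖M x - c • x - ∑ r, γ r • inner ℝ (u r) x • u r‖ ≤ δ * ‖x‖)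
    {x : H} (hx : x ∈ Submodule.span ℝ (Set.range fun r => w (Fin.castLE hRn r)))
    (hx1 : ‖x‖ = 1) :
    1 - 4 * δ ^ 2 / g ^ 2 ≤ ‖(Submodule.span ℝ (Set.range u)).starProjection x‖ := by
  have hδ0 : 0 ≤ δ := by
    have := (norm_nonneg _).trans (hδ x)
    rwa [hx1, mul_one] at this
  -- For a large deviation the left-hand side is not positive.
  by_cases hbig : g < 2 * δ
  · refine le_trans ?_ (norm_nonneg _)
    have : 1 ≤ 4 * δ ^ 2 / g ^ 2 := by
      rw [le_div_iff₀ (by positivity)]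
      nlinarith
    linarith
  rw [not_lt] at hbig
  set U := Submodule.span ℝ (Set.range u)
  set w' : Fin R → H := fun r => w (Fin.castLE hRn r)
  set ν : Fin R → ℝ := fun r => μ (Fin.castLE hRn r) - c
  have hν : ∀ r, g / 2 ≤ ν r := fun r => by
    have := sub_le_eigenvalue_of_perturbation hu hγ hR hRn w hμ hM hδ (Fin.castLE hRn r)
      (by simp)
    simp only [ν]; linarith
  have hw' : Orthonormal ℝ w' := w.orthonormal.comp _ (Fin.castLE_injective hRn)
  obtain ⟨t, rfl⟩ := (Submodule.mem_span_range_iff_exists_fun ℝ).1 hx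
  have hν0 : ∀ r, ν r ≠ 0 := fun r => by linarith [hν r]
  set x := ∑ r, t r • w' r with hxdef
  set y := ∑ r, (t r / ν r) • w' r with hydef
  have hyx : M y - c • y = x := by
    rw [hydef, map_sum, Finset.smul_sum, ← Finset.sum_sub_distrib]
    refine Finset.sum_congr rfl fun r _ => ?_
    rw [map_smul, hM, smul_smul, smul_smul, ← sub_smul]
    congr 1
    have := hν0 r
    simp only [ν] at this ⊢
    field_simp
  have hy : ‖y‖ ≤ 2 / g := by
    apply le_of_sq_le_sq _ (by positivity)
    rw [hydef, hw'.norm_sum_smul_sq]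
    have ht : ∑ r, t r ^ 2 = 1 := by rw [← hw'.norm_sum_smul_sq, hx1, one_pow]
    calc ∑ r, (t r / ν r) ^ 2 ≤ ∑ r, (2 / g) ^ 2 * t r ^ 2 := by
          refine Finset.sum_le_sum fun r _ => ?_
          rw [div_pow, div_eq_inv_mul, ← inv_pow]
          have : (ν r)⁻¹ ≤ 2 / g := by
            rw [← inv_div]
            exact inv_anti₀ (by positivity) (hν r)
          have h0 : 0 ≤ (ν r)⁻¹ := inv_nonneg.2 (by linarith [hν r])
          gcongr
      _ = _ := by rw [← Finset.mul_sum, ht, mul_one]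
  have hmem : ∑ r, γ r • inner ℝ (u r) y • u r ∈ U :=
    Submodule.sum_mem _ fun r _ => Submodule.smul_mem _ _ (Submodule.smul_mem _ _
      (Submodule.subset_span ⟨r, rfl⟩))
  have hdist : ‖x - U.starProjection x‖ ≤ 2 * δ / g := by
    rw [Submodule.starProjection_minimal]
    calc _ ≤ ‖x - (⟨_, hmem⟩ : U)‖ :=
          ciInf_le (f := fun z : U => ‖x - z‖) ⟨0, by rintro _ ⟨_, rfl⟩; positivity⟩ _
      _ ≤ δ * ‖y‖ := by rw [← hyx]; exact hδ y
      _ ≤ δ * (2 / g) := by gcongr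
      _ = _ := by ring
  have hpyth := Submodule.norm_sq_eq_add_norm_sq_starProjection x U
  rw [Submodule.starProjection_orthogonal_val, hx1] at hpyth
  have hsq : ‖x - U.starProjection x‖ ^ 2 ≤ 4 * δ ^ 2 / g ^ 2 := by
    calc _ ≤ (2 * δ / g) ^ 2 := by gcongr
      _ = _ := by ring
  have hle : ‖U.starProjection x‖ ≤ 1 := hx1 ▸ U.norm_starProjection_apply_le x
  nlinarith [norm_nonneg (U.starProjection x)]

end Perturbation

/-! ### The deviation of the noisy Gram matrix -/

section Decomposition

variable {n m R : ℕ} {β : Fin R → ℝ} {u : Fin R → EuclideanSpace ℝ (Fin n)}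
  {v : Fin R → EuclideanSpace ℝ (Fin m)}

lemma signalMatrix_mulVec (z : Fin m → ℝ) :
    (signalMatrix β u v).mulVec z = ∑ r, (β r * ((v r).ofLp ⬝ᵥ z)) • (u r).ofLp := by
  simp [signalMatrix, Matrix.sum_mulVec, Matrix.smul_mulVec, Matrix.vecMulVec_mulVec, smul_smul]

lemma transpose_signalMatrix : (signalMatrix β u v).transpose = signalMatrix β v u := by
  simp [signalMatrix, Matrix.transpose_sum, Matrix.transpose_smul, Matrix.transpose_vecMulVec]

/-- `X̃ X̃ᵀ = X Xᵀ + σ (E Xᵀ + X Eᵀ) + σ² E Eᵀ`, written through the vectors `E (v r)` and the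
columns of `E`. -/
lemma toLp_signalMatrix_add_mul_transpose_mulVec (hv : Orthonormal ℝ v) (σ : ℝ)
    (E : Matrix (Fin n) (Fin m) ℝ) (x : EuclideanSpace ℝ (Fin n)) :
    let b : Fin R → EuclideanSpace ℝ (Fin n) := fun r => WithLp.toLp 2 (E.mulVec (v r).ofLp)
    let a : Fin m → EuclideanSpace ℝ (Fin n) := fun j =>
      WithLp.toLp 2 (E.mulVec (EuclideanSpace.basisFun (Fin m) ℝ j).ofLp)
    WithLp.toLp 2 (((signalMatrix β u v + σ • E) *
        (signalMatrix β u v + σ • E).transpose).mulVec x.ofLp) =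
      ∑ r, β r ^ 2 • inner ℝ (u r) x • u r +
        σ • (∑ r, β r • inner ℝ (u r) x • b r + ∑ r, β r • inner ℝ (b r) x • u r) +
        σ ^ 2 • ∑ j, inner ℝ (a j) x • a j := by
  intro b a
  have hin : ∀ {k : ℕ} (y z : EuclideanSpace ℝ (Fin k)), inner ℝ y z = y.ofLp ⬝ᵥ z.ofLp :=
    fun y z => by simp [PiLp.inner_apply, dotProduct, mul_comm]
  have hvv : ∀ r, (v r).ofLp ⬝ᵥ (∑ s, (β s * ((u s).ofLp ⬝ᵥ x.ofLp)) • (v s).ofLp) =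
      β r * ((u r).ofLp ⬝ᵥ x.ofLp) := by
    intro r
    have := hv.inner_right_fintype (fun s => β s * ((u s).ofLp ⬝ᵥ x.ofLp)) r
    rw [hin] at this
    simpa using this
  have hb : ∀ r, (v r).ofLp ⬝ᵥ E.transpose.mulVec x.ofLp = inner ℝ (b r) x := by
    intro r
    rw [hin, Matrix.dotProduct_mulVec, Matrix.vecMul_transpose]
  have ha : E.mulVec (E.transpose.mulVec x.ofLp) = ∑ j, inner ℝ (a j) x • (a j).ofLp := by
    ext i
    simp [a, hin, Matrix.mulVec, dotProduct, mul_comm]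
  apply (WithLp.equiv 2 (Fin n → ℝ)).injective
  simp only [WithLp.equiv_apply, WithLp.ofLp_add, WithLp.ofLp_smul, WithLp.ofLp_sum]
  rw [← Matrix.mulVec_mulVec, Matrix.transpose_add, Matrix.transpose_smul, transpose_signalMatrix,
    Matrix.add_mulVec, Matrix.add_mulVec, signalMatrix_mulVec, signalMatrix_mulVec,
    Matrix.smul_mulVec, Matrix.smul_mulVec, Matrix.mulVec_add, Matrix.mulVec_smul, ha]
  simp only [dotProduct_add, hvv, dotProduct_smul, hb, Matrix.mulVec_sum, Matrix.mulVec_smul]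
  simp only [hin, smul_add, Finset.smul_sum, smul_smul, add_smul, mul_add, Finset.sum_add_distrib,
    smul_eq_mul, b]
  have e1 : ∀ r, β r * (β r * ((u r).ofLp ⬝ᵥ x.ofLp)) = β r ^ 2 * ((u r).ofLp ⬝ᵥ x.ofLp) :=
    fun r => by ring
  have e2 : ∀ r, β r * (σ * (E.mulVec (v r).ofLp ⬝ᵥ x.ofLp)) =
      σ * (β r * (E.mulVec (v r).ofLp ⬝ᵥ x.ofLp)) := fun r => by ring
  have e3 : ∀ c : ℝ, σ * (σ * c) = σ ^ 2 * c := fun c => by ring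
  simp only [e1, e2, e3]
  abel

/-- A frame bound `∑ ⟪b r, x⟫² ≤ K² ‖x‖²` controls both cross terms, which are adjoint to each
other. -/
lemma norm_cross_terms_le {H : Type*} [NormedAddCommGroup H] [InnerProductSpace ℝ H]
    {u b : Fin R → H} (hu : Orthonormal ℝ u) {β₁ K : ℝ} (hβ0 : ∀ r, 0 ≤ β r)
    (hβ : ∀ r, β r ≤ β₁) (hβ₁ : 0 ≤ β₁) (hK : 0 ≤ K)
    (hb : ∀ x, ∑ r, inner ℝ (b r) x ^ 2 ≤ K ^ 2 * ‖x‖ ^ 2) (x : H) :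
    ‖∑ r, β r • inner ℝ (u r) x • b r + ∑ r, β r • inner ℝ (b r) x • u r‖ ≤
      2 * (β₁ * K) * ‖x‖ := by
  have h2 : ∀ x, ‖∑ r, β r • inner ℝ (b r) x • u r‖ ≤ β₁ * K * ‖x‖ := by
    intro x
    apply le_of_sq_le_sq _ (by positivity)
    simp_rw [smul_smul]
    rw [hu.norm_sum_smul_sq]
    calc ∑ r, (β r * inner ℝ (b r) x) ^ 2 ≤ ∑ r, β₁ ^ 2 * inner ℝ (b r) x ^ 2 := by
          refine Finset.sum_le_sum fun r _ => ?_
          rw [mul_pow]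
          have := hβ0 r
          have := hβ r
          gcongr
      _ = β₁ ^ 2 * ∑ r, inner ℝ (b r) x ^ 2 := by rw [Finset.mul_sum]
      _ ≤ β₁ ^ 2 * (K ^ 2 * ‖x‖ ^ 2) := by gcongr; exact hb x
      _ = _ := by ring
  have h1 : ‖∑ r, β r • inner ℝ (u r) x • b r‖ ≤ β₁ * K * ‖x‖ := by
    set y := ∑ r, β r • inner ℝ (u r) x • b r with hy
    have hadj : inner ℝ y y = inner ℝ (∑ r, β r • inner ℝ (b r) y • u r) x := by
      conv_lhs => rw [hy, sum_inner]
      rw [sum_inner]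
      refine Finset.sum_congr rfl fun r _ => ?_
      simp only [inner_smul_left, conj_trivial]
      ring
    have hle : ‖y‖ * ‖y‖ ≤ (β₁ * K * ‖x‖) * ‖y‖ := by
      rw [← real_inner_self_eq_norm_mul_norm, hadj]
      calc _ ≤ ‖∑ r, β r • inner ℝ (b r) y • u r‖ * ‖x‖ := real_inner_le_norm _ _
        _ ≤ (β₁ * K * ‖y‖) * ‖x‖ := by gcongr; exact h2 y
        _ = _ := by ring
    rcases (norm_nonneg y).eq_or_lt with h0 | h0
    · rw [← h0]; positivity
    · exact le_of_mul_le_mul_right hle h0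
  calc _ ≤ _ := norm_add_le _ _
    _ ≤ _ := add_le_add h1 (h2 x)
    _ = _ := by ring

lemma sum_inner_sq_le_of_norm_frame_sub_le {H ι : Type*} [Fintype ι] [NormedAddCommGroup H]
    [InnerProductSpace ℝ H] {b : ι → H} {c M : ℝ}
    (h : ∀ x, ‖∑ r, inner ℝ (b r) x • b r - c • x‖ ≤ M * ‖x‖) (x : H) :
    ∑ r, inner ℝ (b r) x ^ 2 ≤ (c + M) * ‖x‖ ^ 2 := by
  have h1 := (real_inner_le_norm (∑ r, inner ℝ (b r) x • b r - c • x) x).trans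
    (mul_le_mul_of_nonneg_right (h x) (norm_nonneg x))
  rw [inner_sub_left, inner_smul_left, real_inner_self_eq_norm_sq, sum_inner] at h1
  simp only [inner_smul_left, conj_trivial, ← sq] at h1
  nlinarith

/-- The deviation of `X̃ X̃ᵀ` from `X Xᵀ + σ² m`, on the event that the frame operators of the
vectors `E (v r)` and of the columns of `E` concentrate. -/
lemma norm_gram_sub_le (hu : Orthonormal ℝ u) (hv : Orthonormal ℝ v) (hRn : R ≤ n)
    {β₁ σ : ℝ} (hβ0 : ∀ r, 0 ≤ β r) (hβ : ∀ r, β r ≤ β₁) (hβ₁ : 0 ≤ β₁) (hσ : 0 ≤ σ)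
    {E : Matrix (Fin n) (Fin m) ℝ}
    (h1 : ∀ x : EuclideanSpace ℝ (Fin n),
      ‖∑ r, inner ℝ (WithLp.toLp 2 (E.mulVec (v r).ofLp)) x •
          (WithLp.toLp 2 (E.mulVec (v r).ofLp) : EuclideanSpace ℝ (Fin n)) - (R : ℝ) • x‖ ≤
        544 * (√(R * n) + n) * ‖x‖)
    (h2 : ∀ x : EuclideanSpace ℝ (Fin n),
      ‖∑ j, inner ℝ (WithLp.toLp 2 (E.mulVec (EuclideanSpace.basisFun (Fin m) ℝ j).ofLp)) x •
          (WithLp.toLp 2 (E.mulVec (EuclideanSpace.basisFun (Fin m) ℝ j).ofLp) :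
            EuclideanSpace ℝ (Fin n)) - (m : ℝ) • x‖ ≤
        544 * (√(m * n) + n) * ‖x‖)
    (x : EuclideanSpace ℝ (Fin n)) :
    ‖WithLp.toLp 2 (((signalMatrix β u v + σ • E) *
        (signalMatrix β u v + σ • E).transpose).mulVec x.ofLp) - (σ ^ 2 * m) • x -
        ∑ r, β r ^ 2 • inner ℝ (u r) x • u r‖ ≤
      (66 * (σ * β₁ * √n) + 544 * (σ ^ 2 * √(m * n) + σ ^ 2 * n)) * ‖x‖ := by
  have hRn' : (R : ℝ) ≤ n := mod_cast hRn
  have hsqrt : √((R : ℝ) * n) ≤ n :=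
    Real.sqrt_le_iff.2 ⟨by positivity, by rw [sq]; gcongr⟩
  have hb : ∀ x, ∑ r, inner ℝ (WithLp.toLp 2 (E.mulVec (v r).ofLp)) x ^ 2 ≤
      (33 * √(n : ℝ)) ^ 2 * ‖x‖ ^ 2 := by
    intro x
    refine (sum_inner_sq_le_of_norm_frame_sub_le h1 x).trans ?_
    gcongr
    -- `R + 544 (√(R n) + n) ≤ (1 + 2 · 544) n = 33² n`
    rw [mul_pow, Real.sq_sqrt (by positivity)]
    linarith
  have hcross := norm_cross_terms_le hu hβ0 hβ hβ₁ (by positivity) hb x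
  rw [toLp_signalMatrix_add_mul_transpose_mulVec hv]
  set A := ∑ r, β r ^ 2 • inner ℝ (u r) x • u r
  set F := ∑ j, inner ℝ (WithLp.toLp 2 (E.mulVec (EuclideanSpace.basisFun (Fin m) ℝ j).ofLp)) x •
    (WithLp.toLp 2 (E.mulVec (EuclideanSpace.basisFun (Fin m) ℝ j).ofLp) :
      EuclideanSpace ℝ (Fin n))
  set B := ∑ r, β r • inner ℝ (u r) x • (WithLp.toLp 2 (E.mulVec (v r).ofLp) :
      EuclideanSpace ℝ (Fin n)) +
    ∑ r, β r • inner ℝ (WithLp.toLp 2 (E.mulVec (v r).ofLp)) x • u r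
  have hsplit : A + σ • B + σ ^ 2 • F - (σ ^ 2 * m) • x - A =
      σ • B + σ ^ 2 • (F - (m : ℝ) • x) := by
    rw [smul_sub, smul_smul]; abel
  rw [hsplit]
  calc _ ≤ ‖σ • B‖ + ‖σ ^ 2 • (F - (m : ℝ) • x)‖ := norm_add_le _ _
    _ = σ * ‖B‖ + σ ^ 2 * ‖F - (m : ℝ) • x‖ := by
        rw [norm_smul, norm_smul, Real.norm_of_nonneg hσ, Real.norm_of_nonneg (sq_nonneg σ)]
    _ ≤ σ * (2 * (β₁ * (33 * √n)) * ‖x‖) + σ ^ 2 * (544 * (√(m * n) + n) * ‖x‖) := by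
        gcongr
        exact h2 x
    _ = _ := by ring

end Decomposition

/-! ### Noise regimes and the main bound -/

section Rates

variable {n m R : ℕ}

lemma one_sub_le_subspaceCos (hR : 0 < R) {û : Fin R → EuclideanSpace ℝ (Fin n)}
    {W : Submodule ℝ (EuclideanSpace ℝ (Fin n))} (hû : ‖û ⟨0, hR⟩‖ = 1) {c : ℝ}
    (h : ∀ x ∈ Submodule.span ℝ (Set.range û), ‖x‖ = 1 → c ≤ ‖W.starProjection x‖) :
    c ≤ subspaceCos (Submodule.span ℝ (Set.range û)) W := by
  have : Nonempty {x : EuclideanSpace ℝ (Fin n) //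
      x ∈ Submodule.span ℝ (Set.range û) ∧ ‖x‖ = 1} :=
    ⟨⟨û ⟨0, hR⟩, Submodule.subset_span ⟨_, rfl⟩, hû⟩⟩
  exact le_ciInf fun x => h x.1 x.2.1 x.2.2

/-- The sine-theta theorem applied to `X̃ X̃ᵀ`: a rate `T` that dominates the three terms of the
deviation gives the bound `1 - 10⁷ T² / β_R⁴`. -/
lemma one_sub_le_abs_subspaceCos {β : Fin R → ℝ} {u : Fin R → EuclideanSpace ℝ (Fin n)}
    {v : Fin R → EuclideanSpace ℝ (Fin m)} (hu : Orthonormal ℝ u) (hR : 0 < R)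
    {β₁ βR σ δ T : ℝ} (hβR : 0 < βR) (hβ : ∀ r, βR ≤ β r)
    {E : Matrix (Fin n) (Fin m) ℝ}
    (hδ : ∀ x : EuclideanSpace ℝ (Fin n), ‖WithLp.toLp 2 (((signalMatrix β u v + σ • E) *
        (signalMatrix β u v + σ • E).transpose).mulVec x.ofLp) - (σ ^ 2 * m) • x -
        ∑ r, β r ^ 2 • inner ℝ (u r) x • u r‖ ≤ δ * ‖x‖)
    (hδT : δ = 66 * (σ * β₁ * √n) + 544 * (σ ^ 2 * √(m * n) + σ ^ 2 * n)) (hδ0 : 0 ≤ δ)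
    (h1 : σ * β₁ * √n ≤ T) (h2 : σ ^ 2 * √(m * n) ≤ T) (h3 : σ ^ 2 * n ≤ T)
    {û : Fin R → EuclideanSpace ℝ (Fin n)}
    (hû : IsTopLeftSingularVectors (signalMatrix β u v + σ • E) û) :
    1 - 10 ^ 7 * T ^ 2 / βR ^ 4 ≤ |subspaceCos (Submodule.span ℝ (Set.range û))
      (Submodule.span ℝ (Set.range u))| := by
  obtain ⟨hRn, w, s, hs, hs0, hw, hûw⟩ := hû
  have hûw' : û = fun r => w (Fin.castLE hRn r) := funext hûw
  refine le_trans ?_ (le_abs_self _)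
  have hw0 : ‖û ⟨0, hR⟩‖ = 1 := by rw [hûw]; exact w.orthonormal.1 _
  refine one_sub_le_subspaceCos hR hw0 fun x hx hx1 => ?_
  rw [hûw'] at hx
  set Y := signalMatrix β u v + σ • E
  have hMw : ∀ i, Matrix.toLpLin 2 2 (Y * Y.transpose) (w i) = s i ^ 2 • w i := fun i => by
    apply (WithLp.equiv 2 (Fin n → ℝ)).injective
    simpa using hw i
  have hM : ∀ x, ‖Matrix.toLpLin 2 2 (Y * Y.transpose) x - (σ ^ 2 * m) • x -
      ∑ r, β r ^ 2 • inner ℝ (u r) x • u r‖ ≤ δ * ‖x‖ := fun x => by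
    rw [Matrix.toLpLin_apply]
    exact hδ x
  have hs2 : Antitone fun i => s i ^ 2 := fun i j hij =>
    pow_le_pow_left₀ (hs0 j) (hs hij) 2
  have := one_sub_le_norm_starProjection_of_perturbation hu (γ := fun r => β r ^ 2)
    (g := βR ^ 2) (by positivity) (fun r => pow_le_pow_left₀ hβR.le (hβ r) 2) hR hRn w hs2 hMw
    (c := σ ^ 2 * m) (δ := δ) hM hx hx1
  refine le_trans ?_ this
  -- `66 + 2 · 544 = 1154` and `4 · 1154² ≤ 10⁷`
  have hT : δ ≤ 1154 * T := by linarith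
  have hT2 : 4 * δ ^ 2 ≤ 10 ^ 7 * T ^ 2 := by nlinarith
  rw [← pow_mul]
  exact sub_le_sub_left (div_le_div_of_nonneg_right hT2 (by positivity)) 1

/-- The three regimes of the noise level. In each of them the dominating rate is `σ² √(m n)` or
`σ β₁ √n`. -/
lemma one_sub_le_of_noise_regime {n m β₁ βR σ : ℝ} {cosine : ℝ} (hn : 0 < n) (hm : 0 < m)
    (hβR : 0 < βR) (hβ : βR ≤ β₁) (hσ : 0 < σ)
    (h : ∀ T, σ * β₁ * √n ≤ T → σ ^ 2 * √(m * n) ≤ T → σ ^ 2 * n ≤ T →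
      1 - 10 ^ 7 * T ^ 2 / βR ^ 4 ≤ cosine) :
    (10 ^ 7 * (β₁ / βR) ^ 4 ≤ m / n →
      (β₁ / √m < σ → 1 - 10 ^ 7 * m * n / (βR / σ) ^ 4 ≤ cosine) ∧
      (σ ≤ β₁ / √m → 1 - 10 ^ 7 * n * (β₁ / βR) ^ 2 / (βR / σ) ^ 2 ≤ cosine)) ∧
    (¬ 10 ^ 7 * (β₁ / βR) ^ 4 ≤ m / n → σ ≤ βR ^ 2 / (√(10 ^ 7 * n) * β₁) →
      1 - 10 ^ 7 * n * (β₁ / βR) ^ 2 / (βR / σ) ^ 2 ≤ cosine) := by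
  have hβ₁ : 0 < β₁ := hβR.trans_le hβ
  have hsm : 0 < √m := Real.sqrt_pos.2 hm
  have hsn : 0 < √n := Real.sqrt_pos.2 hn
  have hm2 : √m ^ 2 = m := Real.sq_sqrt hm.le
  have hn2 : √n ^ 2 = n := Real.sq_sqrt hn.le
  have hmn : √(m * n) = √m * √n := Real.sqrt_mul hm.le n
  have hrate : 10 ^ 7 * (σ * β₁ * √n) ^ 2 / βR ^ 4 =
      10 ^ 7 * n * (β₁ / βR) ^ 2 / (βR / σ) ^ 2 := by
    rw [mul_pow, hn2]; field_simp
  have hrate' : 10 ^ 7 * (σ ^ 2 * √(m * n)) ^ 2 / βR ^ 4 = 10 ^ 7 * m * n / (βR / σ) ^ 4 := by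
    rw [mul_pow, Real.sq_sqrt (by positivity)]; field_simp
  rw [← hrate, ← hrate']
  refine ⟨fun hbig => ?_, fun hsmall hσ' => ?_⟩
  · have hnm : n ≤ m := by
      have h1 : 1 ≤ β₁ / βR := (one_le_div hβR).2 hβ
      have h2 : 1 ≤ (β₁ / βR) ^ 4 := one_le_pow₀ h1
      have h3 : 1 ≤ m / n := by linarith
      exact (one_le_div hn).1 h3
    have hle : n ≤ √(m * n) := Real.le_sqrt_of_sq_le (by rw [sq]; gcongr)
    have h3 : σ ^ 2 * n ≤ σ ^ 2 * √(m * n) := by gcongr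
    refine ⟨fun hσ' => h _ ?_ le_rfl h3, fun hσ' => ?_⟩
    · rw [div_lt_iff₀ hsm] at hσ'
      calc σ * β₁ * √n ≤ σ * (σ * √m) * √n := by gcongr
        _ = _ := by rw [hmn]; ring
    · rw [le_div_iff₀ hsm] at hσ'
      have h2 : σ ^ 2 * √(m * n) ≤ σ * β₁ * √n := by
        calc _ = σ * (σ * √m) * √n := by rw [hmn]; ring
          _ ≤ _ := by gcongr
      exact h _ le_rfl h2 (h3.trans h2)
  · rw [le_div_iff₀ (by positivity)] at hσ'
    have hsq : σ ^ 2 * (10 ^ 7 * n) * β₁ ^ 2 ≤ βR ^ 4 := by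
      calc _ = (σ * (√(10 ^ 7 * n) * β₁)) ^ 2 := by
            rw [mul_pow, mul_pow, Real.sq_sqrt (by positivity)]; ring
        _ ≤ (βR ^ 2) ^ 2 := by gcongr
        _ = _ := by ring
    have hm' : m * βR ^ 4 ≤ 10 ^ 7 * n * β₁ ^ 4 := by
      rw [not_le, div_lt_iff₀ hn, div_pow] at hsmall
      have : m * βR ^ 4 ≤ (10 ^ 7 * (β₁ ^ 4 / βR ^ 4) * n) * βR ^ 4 := by gcongr
      refine this.trans (le_of_eq ?_)
      field_simp
    have hσm : σ ^ 2 * m ≤ β₁ ^ 2 := by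
      have hpos : 0 < 10 ^ 7 * n * β₁ ^ 2 := by positivity
      refine le_of_mul_le_mul_right ?_ hpos
      calc σ ^ 2 * m * (10 ^ 7 * n * β₁ ^ 2) = (σ ^ 2 * (10 ^ 7 * n) * β₁ ^ 2) * m := by ring
        _ ≤ βR ^ 4 * m := by gcongr
        _ ≤ 10 ^ 7 * n * β₁ ^ 4 := by linarith
        _ = _ := by ring
    have hσn : σ ^ 2 * n ≤ β₁ ^ 2 := by
      have hpos : 0 < β₁ ^ 2 := by positivity
      refine le_of_mul_le_mul_right ?_ hpos
      have h4 : βR ^ 4 ≤ β₁ ^ 4 := by gcongr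
      have h5 : 0 ≤ σ ^ 2 * n * β₁ ^ 2 := by positivity
      nlinarith
    have hσm' : σ * √m ≤ β₁ := le_of_sq_le_sq (by rw [mul_pow, hm2]; exact hσm) hβ₁.le
    have hσn' : σ * √n ≤ β₁ := le_of_sq_le_sq (by rw [mul_pow, hn2]; exact hσn) hβ₁.le
    refine h _ le_rfl ?_ ?_
    · calc _ = σ * (σ * √m) * √n := by rw [hmn]; ring
        _ ≤ _ := by gcongr
    · calc σ ^ 2 * n = σ * (σ * √n) * √n := by
            rw [show σ * (σ * √n) * √n = σ ^ 2 * √n ^ 2 by ring, hn2]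
        _ ≤ _ := by gcongr

end Rates

theorem mainTheorem4 :
    ∃ C : ℝ, 0 < C ∧
      ∀ (n m R : ℕ) (hR : 0 < R) (β : Fin R → ℝ)
        (u : Fin R → EuclideanSpace ℝ (Fin n)) (v : Fin R → EuclideanSpace ℝ (Fin m))
        (σ β₁ βR : ℝ),
        Orthonormal ℝ u → Orthonormal ℝ v →
        Antitone β → β₁ = β ⟨0, hR⟩ → βR = β ⟨R - 1, Nat.sub_lt hR Nat.one_pos⟩ → 0 < βR →
        0 < σ →
        ∀ (Ω : Type*) [MeasurableSpace Ω] (P : Measure Ω) [IsProbabilityMeasure P]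
          (E : Ω → Matrix (Fin n) (Fin m) ℝ),
          (∀ i j, HasLaw (fun ω => E ω i j) (gaussianReal 0 1) P) →
          iIndepFun (fun (p : Fin n × Fin m) (ω : Ω) => E ω p.1 p.2) P →
          ∃ A : Set Ω, MeasurableSet A ∧
            ENNReal.ofReal (1 - 3 * Real.exp (-(n : ℝ))) ≤ P A ∧
            ∀ ω ∈ A, ∀ û : Fin R → EuclideanSpace ℝ (Fin n),
              IsTopLeftSingularVectors (signalMatrix β u v + σ • E ω) û →
              ((C * (β₁ / βR) ^ 4 ≤ (m : ℝ) / n →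
                (β₁ / √(m : ℝ) < σ → σ ≤ βR / (C * m * n) ^ ((1 : ℝ) / 4) →
                  1 - C * m * n / (βR / σ) ^ 4 ≤
                    |subspaceCos (Submodule.span ℝ (Set.range û))
                      (Submodule.span ℝ (Set.range u))|) ∧
                (σ ≤ β₁ / √(m : ℝ) →
                  1 - C * n * (β₁ / βR) ^ 2 / (βR / σ) ^ 2 ≤
                    |subspaceCos (Submodule.span ℝ (Set.range û))
                      (Submodule.span ℝ (Set.range u))|)) ∧
              (¬ C * (β₁ / βR) ^ 4 ≤ (m : ℝ) / n →
                σ ≤ βR ^ 2 / (√(C * n) * β₁) →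
                  1 - C * n * (β₁ / βR) ^ 2 / (βR / σ) ^ 2 ≤
                    |subspaceCos (Submodule.span ℝ (Set.range û))
                      (Submodule.span ℝ (Set.range u))|)) := by
  refine ⟨10 ^ 7, by norm_num, ?_⟩
  intro n m R hR β u v σ β₁ βR hu hv hβ hβ₁ hβR hβRpos hσ Ω _ P _ E hlaw hind
  have hRn : R ≤ n := by simpa using hu.linearIndependent.fintype_card_le_finrank
  have hRm : R ≤ m := by simpa using hv.linearIndependent.fintype_card_le_finrank
  have hn : 0 < n := hR.trans_le hRn
  have hm : 0 < m := hR.trans_le hRm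
  have hle : ∀ r, β r ≤ β₁ := fun r => hβ₁ ▸ hβ (Fin.le_def.2 (Nat.zero_le _))
  have hge : ∀ r, βR ≤ β r := fun r => hβR ▸ hβ (Fin.le_def.2 (Nat.le_sub_one_of_lt r.2))
  have hβ₁R : βR ≤ β₁ := (hge ⟨0, hR⟩).trans (hle _)
  have hβ₁0 : 0 < β₁ := hβRpos.trans_le hβ₁R
  obtain ⟨B₁, hP1, hB₁⟩ := exists_event_norm_frame_mulVec_sub_le hlaw hind hn hv
  obtain ⟨B₂, hP2, hB₂⟩ := exists_event_norm_frame_mulVec_sub_le hlaw hind hn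
    (EuclideanSpace.basisFun (Fin m) ℝ).orthonormal
  rw [Fintype.card_fin] at hB₁ hB₂
  -- The entries of `E` are only a.e. measurable, hence the measurable hull of the bad event.
  refine ⟨(toMeasurable P (B₁ ∪ B₂))ᶜ, (measurableSet_toMeasurable _ _).compl, ?_, ?_⟩
  · rw [prob_compl_eq_one_sub (measurableSet_toMeasurable _ _), measure_toMeasurable,
      ENNReal.ofReal_sub _ (by positivity), ENNReal.ofReal_one]
    refine tsub_le_tsub_left ?_ _
    calc P (B₁ ∪ B₂) ≤ P B₁ + P B₂ := measure_union_le _ _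
      _ ≤ ENNReal.ofReal (Real.exp (-n)) + ENNReal.ofReal (Real.exp (-n)) := add_le_add hP1 hP2
      _ = ENNReal.ofReal (Real.exp (-n) + Real.exp (-n)) :=
          (ENNReal.ofReal_add (by positivity) (by positivity)).symm
      _ ≤ _ := ENNReal.ofReal_le_ofReal (by linarith [Real.exp_pos (-(n : ℝ))])
  · intro ω hω û hû
    have hω' : ω ∉ B₁ ∪ B₂ := fun h => hω (subset_toMeasurable _ _ h)
    rw [Set.mem_union, not_or] at hω'
    have hδ := norm_gram_sub_le hu hv hRn (fun r => hβRpos.le.trans (hge r)) hle hβ₁0.le hσ.le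
      (hB₁ ω hω'.1) (hB₂ ω hω'.2)
    have h := one_sub_le_of_noise_regime (n := n) (m := m) (mod_cast hn) (mod_cast hm) hβRpos
      hβ₁R hσ fun T h1 h2 h3 => one_sub_le_abs_subspaceCos hu hR hβRpos hge hδ rfl (by positivity)
        h1 h2 h3 hû
    exact ⟨fun hbig => ⟨fun hlow _ => (h.1 hbig).1 hlow, (h.1 hbig).2⟩, h.2⟩
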